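/- **Conventions.** A *2-plectic manifold* $(X,\omega)$ is a (finite-dimensional, Hausdorff, second countable, boundaryless) smooth manifold $X$ with a smooth 3-form $\omega$ that is closed, $d\omega=0$, and nondegenerate: for $v\in T_xX$, $\iota_v\omega=\omega(v,\cdot,\cdot)=0$ implies $v=0$. A smooth 1-form $F$ on $X$ is *Hamiltonian* if there is a smooth vector field $v_F$ with $dF=-\iota_{v_F}\omega$; then $v_F$ is unique. $\mathrm{Ham}(X)$ is the real vector space of Hamiltonian 1-forms. A *Lie 2-algebra* is a 2-term complex of vector spaces $L=(L_0\xleftarrow{d}L_1)$ with * a chain map $[\cdot,\cdot]\colon L\otimes L\to L$ (the *bracket*), i.e. bilinear brackets $[x,y]\in L_0$, $[x,f]\in L_1$, $[f,x]\in L_1$ for $x,y\in L_0$, $f\in L_1$ (and $0$ on $L_1\otimes L_1$) with $d[x,f]=[x,df]$, $d[f,x]=[df,x]$, $[df,g]=[f,dg]$; * a chain homotopy $S\colon[\cdot,\cdot]\Rightarrow-[\cdot,\cdot]\circ\sigma$ (the *alternator*; $\sigma$ is the switch), i.e. a bilinear map $S\colon L_0\times L_0\to L_1$ with $[x,y]+dS_{x,y}=-[y,x]$,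 $[x,f]+S_{x,df}=-[f,x]$, $[f,x]+S_{df,x}=-[x,f]$; * an antisymmetric chain homotopy $J\colon[\cdot,[\cdot,\cdot]]\Rightarrow[[\cdot,\cdot],\cdot]+[\cdot,[\cdot,\cdot]]\circ(\sigma\otimes1)$ (the *Jacobiator*), i.e. an antisymmetric trilinear map $J\colon L_0^3\to L_1$ with $[x,[y,z]]+dJ_{x,y,z}=[[x,y],z]+[y,[x,z]]$, and likewise, when exactly one of the three arguments $a,b,c$ is a 1-chain, $[a,[b,c]]+J_{a,b,c}=[[a,b],c]+[b,[a,c]]$ with the 1-chain $f$ replaced by $df$ inside $J$; such that for all $w,x,y,z\in L_0$ 1. $[w,J_{x,y,z}]+J_{w,[x,y],z}+J_{w,y,[x,z]}+[J_{w,x,y},z]+[y,J_{w,x,z}]=J_{w,x,[y,z]}+J_{[w,x],y,z}+[x,J_{w,y,z}]+J_{x,[w,y],z}+J_{x,y,[w,z]}$, 2. $[S_{x,y},z]+J_{y,x,z}=-J_{x,y,z}$, 3. $[x,S_{y,z}]-J_{x,z,y}=J_{x,y,z}+S_{[x,y],z}+S_{y,[x,z]}$, 4. $S_{x,[y,z]}-S_{[y,z],x}=0$.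 It is *hemistrict* if $J=0$. **Theorem.** Let $(X,\omega)$ be a 2-plectic manifold. There is a hemistrict Lie 2-algebra $L(X,\omega)_{\mathrm h}$ over $\mathbb R$ such that * the space of 0-chains is $\mathrm{Ham}(X)$ and the space of 1-chains is $C^\infty(X)$; * the differential is the exterior derivative $d\colon C^\infty(X)\to\mathrm{Ham}(X)$; * the bracket is the hemi-bracket: $\{F,G\}_{\mathrm h}=L_{v_F}G$, $\{F,f\}_{\mathrm h}=L_{v_F}f$, $\{f,F\}_{\mathrm h}=0$ for $F,G\in\mathrm{Ham}(X)$, $f\in C^\infty(X)$; * the alternator is $S_{F,G}=-(\iota_{v_F}G+\iota_{v_G}F)$; * the Jacobiator is the identity chain homotopy: $J_{F,G,H}=0$. -/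

import Mathlib

open scoped Manifold ContDiff Bundle

noncomputable section

namespace TwoPlectic

section Forms

variable {E : Type*} [NormedAddCommGroup E] [NormedSpace ℝ E]
  {H : Type*} [TopologicalSpace H] (I : ModelWithCorners ℝ E H)
  {X : Type*} [TopologicalSpace X] [ChartedSpace H X]

/-- The expression of a (not necessarily smooth) `k`-form `η` on `X` in the chart around `x₀`:
the pullback of `η` along the inverse of that chart, a `k`-form on the model space `E`. It is
meaningful on the target of the chart. -/
def chartRep {k : ℕ} (η : ∀ x : X, TangentSpace I x [⋀^Fin k]→L[ℝ] ℝ) (x₀ : X) (y : E) :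
    E [⋀^Fin k]→L[ℝ] ℝ :=
  (η ((extChartAt I x₀).symm y)).compContinuousLinearMap
    (mfderivWithin 𝓘(ℝ, E) I (extChartAt I x₀).symm (Set.range I) y)

variable (X) in
/-- The real vector space `Ω^k(X)` of smooth differential `k`-forms on `X`: families of
alternating `k`-linear forms on the tangent spaces that are smooth in every chart. -/
def Ω (k : ℕ) : Submodule ℝ (∀ x : X, TangentSpace I x [⋀^Fin k]→L[ℝ] ℝ) where
  carrier := {η | ∀ x₀ : X, ContDiffOn ℝ ∞ (chartRep I η x₀) (extChartAt I x₀).target}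
  zero_mem' _ := contDiffOn_const (c := 0)
  add_mem' hη hθ x₀ := (hη x₀).add (hθ x₀)
  smul_mem' c _ hη x₀ := (hη x₀).const_smul c

/-- The exterior derivative of a form at the point `x`, computed in the chart around `x`. -/
def extDerivAt {k : ℕ} (η : ∀ x : X, TangentSpace I x [⋀^Fin k]→L[ℝ] ℝ) (x : X) :
    TangentSpace I x [⋀^Fin (k + 1)]→L[ℝ] ℝ :=
  (extDeriv (chartRep I η x) (extChartAt I x x)).compContinuousLinearMap
    (mfderiv I 𝓘(ℝ, E) (extChartAt I x) x)

/-- The interiorProduct product `ι_v α = α(v, ·, …, ·)` of a tangent vector with an alternating form. -/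
def interiorProduct {k : ℕ} {x : X} (v : TangentSpace I x) (α : TangentSpace I x [⋀^Fin (k + 1)]→L[ℝ] ℝ) :
    TangentSpace I x [⋀^Fin k]→L[ℝ] ℝ :=
  { α.toAlternatingMap.curryLeft v with
    cont := α.cont.comp (continuous_const.matrixVecCons continuous_id) }

theorem interiorProduct_apply {k : ℕ} {x : X} (v : TangentSpace I x)
    (α : TangentSpace I x [⋀^Fin (k + 1)]→L[ℝ] ℝ) (u : Fin k → TangentSpace I x) :
    interiorProduct I v α u = α (Matrix.vecCons v u) := rfl

theorem interiorProduct_add {k : ℕ} {x : X} (v w : TangentSpace I x)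
    (α : TangentSpace I x [⋀^Fin (k + 1)]→L[ℝ] ℝ) :
    interiorProduct I (v + w) α = interiorProduct I v α + interiorProduct I w α := by
  ext u
  exact α.toAlternatingMap.map_vecCons_add u v w

theorem interiorProduct_smul {k : ℕ} {x : X} (c : ℝ) (v : TangentSpace I x)
    (α : TangentSpace I x [⋀^Fin (k + 1)]→L[ℝ] ℝ) :
    interiorProduct I (c • v) α = c • interiorProduct I v α := by
  ext u
  exact α.toAlternatingMap.map_vecCons_smul u c v

/-- The pairing `ι_v α = α(v)` of a tangent vector with a `1`-form, as a real number. -/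
def pairing {x : X} (v : TangentSpace I x) (α : TangentSpace I x [⋀^Fin 1]→L[ℝ] ℝ) : ℝ :=
  α ![v]

/-- The exterior derivative of a function `f` at `x`, a `1`-form: `(df)_x(v) = v(f)`. -/
def dFun (f : X → ℝ) (x : X) : TangentSpace I x [⋀^Fin 1]→L[ℝ] ℝ :=
  ContinuousAlternatingMap.ofSubsingleton ℝ (TangentSpace I x) ℝ (0 : Fin 1)
    (mfderiv I 𝓘(ℝ, ℝ) f x)

/-- The Lie derivative of a function along a vector field: `L_v f = v(f) = df(v)`. -/
def lieDerivFun (v : ∀ x : X, TangentSpace I x) (f : X → ℝ) (x : X) : ℝ :=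
  mfderiv I 𝓘(ℝ, ℝ) f x (v x)

/-- The expression of a vector field on `X` in the chart around `x₀`: its pullback along the
inverse of that chart. -/
def chartRepField (v : ∀ x : X, TangentSpace I x) (x₀ : X) (y : E) : E :=
  VectorField.mpullbackWithin 𝓘(ℝ, E) I (extChartAt I x₀).symm v (Set.range I) y

/-- The Lie derivative of a `1`-form on a normed space along a vector field,
`(L_V η)_y(w) = (D_{V(y)} η)(w) + η_y(D_w V)`; in coordinates this is
`(L_V η)_i = V^j ∂_j η_i + η_j ∂_i V^j`. -/
def lieDerivModel (V : E → E) (η : E → E [⋀^Fin 1]→L[ℝ] ℝ) (y : E) : E [⋀^Fin 1]→L[ℝ] ℝ :=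
  fderiv ℝ η y (V y) + (η y).compContinuousLinearMap (fderiv ℝ V y)

/-- The Lie derivative `L_v η` of a `1`-form along a vector field at the point `x`, computed in
the chart around `x`. -/
def lieDeriv (v : ∀ x : X, TangentSpace I x) (η : ∀ x : X, TangentSpace I x [⋀^Fin 1]→L[ℝ] ℝ)
    (x : X) : TangentSpace I x [⋀^Fin 1]→L[ℝ] ℝ :=
  (lieDerivModel (chartRepField I v x) (chartRep I η x) (extChartAt I x x)).compContinuousLinearMap
    (mfderiv I 𝓘(ℝ, E) (extChartAt I x) x)

variable {I} in
/-- A `2`-plectic structure: a closed and nondegenerate (smooth) `3`-form. -/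
structure IsTwoPlectic (ω₃ : Ω I X 3) : Prop where
  closed : ∀ x : X, extDerivAt I ω₃.1 x = 0
  nondegenerate : ∀ (x : X) (v : TangentSpace I x), interiorProduct I v (ω₃.1 x) = 0 → v = 0

theorem chartRep_differentiableAt [I.Boundaryless] {k : ℕ} (η : Ω I X k) (x : X) :
    DifferentiableAt ℝ (chartRep I η.1 x) (extChartAt I x x) :=
  ((η.2 x).contDiffAt (extChartAt_target_mem_nhds x)).differentiableAt (by simp)

theorem extDerivAt_add [I.Boundaryless] {k : ℕ} (η θ : Ω I X k) (x : X) :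
    extDerivAt I (η + θ).1 x = extDerivAt I η.1 x + extDerivAt I θ.1 x := by
  have h : chartRep I (η + θ).1 x = chartRep I η.1 x + chartRep I θ.1 x := rfl
  unfold extDerivAt
  rw [h, extDeriv_add (chartRep_differentiableAt I η x) (chartRep_differentiableAt I θ x)]
  rfl

theorem extDerivAt_smul {k : ℕ} (c : ℝ) (η : Ω I X k) (x : X) :
    extDerivAt I (c • η).1 x = c • extDerivAt I η.1 x := by
  have h : chartRep I (c • η).1 x = c • chartRep I η.1 x := rfl
  unfold extDerivAt
  rw [h, extDeriv_smul]
  rfl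

end Forms

section Hamiltonian

variable {E : Type*} [NormedAddCommGroup E] [NormedSpace ℝ E]
  {H : Type*} [TopologicalSpace H] {I : ModelWithCorners ℝ E H}
  {X : Type*} [TopologicalSpace X] [ChartedSpace H X] [IsManifold I ∞ X]

/-- The smooth vector field `v` is a Hamiltonian vector field of the `1`-form `F`:
`dF = -ι_v ω`. -/
def IsHamiltonianField (ω₃ : Ω I X 3)
    (F : ∀ x : X, TangentSpace I x [⋀^Fin 1]→L[ℝ] ℝ)
    (v : Cₛ^∞⟮I; E, (TangentSpace I : X → Type _)⟯) : Prop :=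
  ∀ x : X, extDerivAt I F x = -interiorProduct I (v x) (ω₃.1 x)

/-- The real vector space `Ham(X)` of Hamiltonian `1`-forms: the smooth `1`-forms that have a
smooth Hamiltonian vector field. -/
def Ham [I.Boundaryless] (ω₃ : Ω I X 3) :
    Submodule ℝ (∀ x : X, TangentSpace I x [⋀^Fin 1]→L[ℝ] ℝ) where
  carrier := {F | F ∈ Ω I X 1 ∧ ∃ v, IsHamiltonianField ω₃ F v}
  zero_mem' := ⟨(Ω I X 1).zero_mem, 0, fun x => by
    have h := extDerivAt_smul I (0 : ℝ) (0 : Ω I X 1) x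
    have h' := interiorProduct_smul I (0 : ℝ) (0 : TangentSpace I x) (ω₃.1 x)
    rw [smul_zero, zero_smul] at h h'
    rw [ContMDiffSection.coe_zero, Pi.zero_apply, h', neg_zero]
    exact h⟩
  add_mem' := by
    rintro F G ⟨hF, v, hv⟩ ⟨hG, w, hw⟩
    refine ⟨(Ω I X 1).add_mem hF hG, v + w, fun x => ?_⟩
    rw [ContMDiffSection.coe_add, Pi.add_apply, interiorProduct_add, neg_add, ← hv x, ← hw x]
    exact extDerivAt_add I ⟨F, hF⟩ ⟨G, hG⟩ x
  smul_mem' := by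
    rintro c F ⟨hF, v, hv⟩
    refine ⟨(Ω I X 1).smul_mem c hF, c • v, fun x => ?_⟩
    have h : extDerivAt I (c • F) x = c • extDerivAt I F x := extDerivAt_smul I c ⟨F, hF⟩ x
    rw [ContMDiffSection.coe_smul, Pi.smul_apply, interiorProduct_smul, h, hv x]
    ext u
    simp

/-- The Hamiltonian vector field `v_F` of a Hamiltonian `1`-form `F`. -/
def hamField [I.Boundaryless] {ω₃ : Ω I X 3} (F : Ham ω₃) :
    Cₛ^∞⟮I; E, (TangentSpace I : X → Type _)⟯ :=
  F.2.2.choose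

theorem hamField_spec [I.Boundaryless] {ω₃ : Ω I X 3} (F : Ham ω₃) :
    IsHamiltonianField ω₃ F.1 (hamField F) :=
  F.2.2.choose_spec

/-- On a `2`-plectic manifold the Hamiltonian vector field of `F` is unique, so `v_F` does not
depend on a choice. -/
theorem hamField_unique [I.Boundaryless] {ω₃ : Ω I X 3} (hω : IsTwoPlectic ω₃) (F : Ham ω₃)
    (v : Cₛ^∞⟮I; E, (TangentSpace I : X → Type _)⟯) (hv : IsHamiltonianField ω₃ F.1 v) :
    v = hamField F := by
  ext x
  have h : interiorProduct I (v x) (ω₃.1 x) = interiorProduct I (hamField F x) (ω₃.1 x) :=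
    neg_injective ((hv x).symm.trans (hamField_spec F x))
  refine sub_eq_zero.1 (hω.nondegenerate x _ ?_)
  rw [sub_eq_add_neg, ← neg_one_smul ℝ (hamField F x), interiorProduct_add, interiorProduct_smul, h]
  ext u
  simp

end Hamiltonian

end TwoPlectic

/-- A Lie 2-algebra whose underlying 2-term chain complex of vector spaces over `k` is
`L₀ ⟵ L₁`. Tensor products of complexes are the usual ones, so the bracket `L ⊗ L → L` has the
components `bracket : L₀ ⊗ L₀ → L₀`, `bracket₀₁ : L₀ ⊗ L₁ → L₁` and `bracket₁₀ : L₁ ⊗ L₀ → L₁`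
(on `L₁ ⊗ L₁` it takes values in `L₂ = 0`), and the chain homotopies `S` and `J`, of degree one,
have only a component on tensors of 0-chains. -/
structure Lie2Algebra (k : Type*) [Field k] (L₀ L₁ : Type*) [AddCommGroup L₀] [Module k L₀]
    [AddCommGroup L₁] [Module k L₁] where
  /-- the differential -/
  d : L₁ →ₗ[k] L₀
  /-- the bracket on 0-chains -/
  bracket : L₀ →ₗ[k] L₀ →ₗ[k] L₀
  /-- the bracket of a 0-chain and a 1-chain -/
  bracket₀₁ : L₀ →ₗ[k] L₁ →ₗ[k] L₁
  /-- the bracket of a 1-chain and a 0-chain -/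
  bracket₁₀ : L₁ →ₗ[k] L₀ →ₗ[k] L₁
  /-- the alternator -/
  S : L₀ →ₗ[k] L₀ →ₗ[k] L₁
  /-- the Jacobiator -/
  J : L₀ →ₗ[k] L₀ →ₗ[k] L₀ →ₗ[k] L₁
  /-
  The bracket is a chain map `L ⊗ L → L` (degrees 1, 1, 2).
  -/
  d_bracket₀₁ : ∀ x f, d (bracket₀₁ x f) = bracket x (d f)
  d_bracket₁₀ : ∀ f x, d (bracket₁₀ f x) = bracket (d f) x
  bracket_d_d : ∀ f g, bracket₀₁ (d f) g - bracket₁₀ f (d g) = 0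
  /-
  `S` is a chain homotopy `[·,·] ⇒ -[·,·] ∘ σ`, where `σ` is the switch (degrees 0, 1, 1).
  -/
  d_S : ∀ x y, bracket x y + d (S x y) = -bracket y x
  S_d_right : ∀ x f, bracket₀₁ x f + S x (d f) = -bracket₁₀ f x
  S_d_left : ∀ f x, bracket₁₀ f x + S (d f) x = -bracket₀₁ x f
  /-
  `J` is a chain homotopy `[·,[·,·]] ⇒ [[·,·],·] + [·,[·,·]] ∘ (σ ⊗ 1)` (degrees 0, 1, 1, 1).
  -/
  d_J : ∀ x y z,
    bracket x (bracket y z) + d (J x y z) = bracket (bracket x y) z + bracket y (bracket x z)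
  J_d_right : ∀ x y f, bracket₀₁ x (bracket₀₁ y f) + J x y (d f) =
    bracket₀₁ (bracket x y) f + bracket₀₁ y (bracket₀₁ x f)
  J_d_middle : ∀ x f z, bracket₀₁ x (bracket₁₀ f z) + J x (d f) z =
    bracket₁₀ (bracket₀₁ x f) z + bracket₁₀ f (bracket x z)
  J_d_left : ∀ f y z, bracket₁₀ f (bracket y z) + J (d f) y z =
    bracket₁₀ (bracket₁₀ f y) z + bracket₀₁ y (bracket₁₀ f z)
  /-
  `J` is antisymmetric.
  -/
  J_antisymm_left : ∀ x y z, J x y z = -J y x z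
  J_antisymm_right : ∀ x y z, J x y z = -J x z y
  /-
  The two ways of rebracketing `[w,[x,[y,z]]]` into
  `[[[w,x],y],z] + [y,[[w,x],z]] + [[x,[w,y]],z] + [[w,y],[x,z]] + [[x,y],[w,z]] + [y,[x,[w,z]]]`
  agree. Here and below a composite of 1-chains `x → y → z` is their sum.
  -/
  coherence_J : ∀ w x y z,
    bracket₀₁ w (J x y z) + (J w (bracket x y) z + J w y (bracket x z)) +
        (bracket₁₀ (J w x y) z + bracket₀₁ y (J w x z)) =
      J w x (bracket y z) + (J (bracket w x) y z + bracket₀₁ x (J w y z)) +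
        (J x (bracket w y) z + J x y (bracket w z))
  /-
  `[[x,y],z] → -[[y,x],z] → [x,[y,z]] - [y,[x,z]]` agrees with
  `[[x,y],z] → [x,[y,z]] - [y,[x,z]]`.
  -/
  coherence_S_left : ∀ x y z, bracket₁₀ (S x y) z + J y x z = -J x y z
  /-
  `[x,[y,z]] → -[x,[z,y]] → -[[x,z],y] - [z,[x,y]]` agrees with
  `[x,[y,z]] → [[x,y],z] + [y,[x,z]] → -[[x,z],y] - [z,[x,y]]`.
  -/
  coherence_S_right : ∀ x y z,
    bracket₀₁ x (S y z) + -J x z y = J x y z + (S (bracket x y) z + S y (bracket x z))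
  /-
  `[x,[y,z]] → -[[y,z],x] → [x,[y,z]]` is the identity.
  -/
  coherence_S_symm : ∀ x y z, S x (bracket y z) + -S (bracket y z) x = 0

/-- A Lie 2-algebra is hemistrict if its Jacobiator is the identity chain homotopy. -/
def Lie2Algebra.IsHemistrict {k : Type*} [Field k] {L₀ L₁ : Type*} [AddCommGroup L₀] [Module k L₀]
    [AddCommGroup L₁] [Module k L₁] (L : Lie2Algebra k L₀ L₁) : Prop :=
  ∀ x y z, L.J x y z = 0

end

/-!
Cartan calculus on forms, `L_v = ι_v d + d ι_v` and `[L_v, ι_w] = ι_[v, w]`, does all the work.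
Closedness of `ω` and `ι_{v_F} ω = -dF` give `L_{v_F} ω = 0`, hence
`d (L_{v_F} G) = -L_{v_F} ι_{v_G} ω = -ι_[v_F, v_G] ω`: the hemi-bracket of `F` and `G` is
Hamiltonian with vector field `[v_F, v_G]`, and its Leibniz identity is `[L_v, L_w] = L_[v, w]`.
Since `ι_v ι_w ω` is antisymmetric in `v` and `w`, the symmetrised bracket is the differential of
`P(F, G) = ι_{v_F} G + ι_{v_G} F`, which is invariant under `L_{v_K}`. A Leibniz algebra with such
a pairing is a hemistrict Lie 2-algebra, with alternator `-P`.
-/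

section HemistrictOfPairing

variable {k : Type*} [Field k] {L₀ L₁ : Type*} [AddCommGroup L₀] [Module k L₀]
  [AddCommGroup L₁] [Module k L₁]

/-- The hemistrict Lie 2-algebra determined by a differential `d`, a bracket on 0-chains that makes
them a left Leibniz algebra in which exact elements act trivially on the left, and an invariant
symmetric pairing `P` whose differential is the symmetrised bracket. The bracket of a 0-chain `x`
and a 1-chain `f` is `P x (d f)`, that of `f` and `x` is zero, and the alternator is `-P`. -/
def Lie2Algebra.hemistrictOfPairing (d : L₁ →ₗ[k] L₀) (bracket : L₀ →ₗ[k] L₀ →ₗ[k] L₀)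
    (P : L₀ →ₗ[k] L₀ →ₗ[k] L₁) (P_comm : ∀ x y, P x y = P y x)
    (P_d_d : ∀ f g, P (d f) (d g) = 0) (bracket_d : ∀ f x, bracket (d f) x = 0)
    (d_P : ∀ x y, d (P x y) = bracket x y + bracket y x)
    (leibniz : ∀ x y z, bracket x (bracket y z) =
      bracket (bracket x y) z + bracket y (bracket x z))
    (P_invariant : ∀ x y z, P x (d (P y z)) = P (bracket x y) z + P y (bracket x z)) :
    Lie2Algebra k L₀ L₁ where
  d := d
  bracket := bracket
  bracket₀₁ := P.compl₂ d
  bracket₁₀ := 0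
  S := -P
  J := 0
  d_bracket₀₁ x f := by simp [d_P, bracket_d]
  d_bracket₁₀ f x := by simp [bracket_d]
  bracket_d_d f g := by simp [P_d_d]
  d_S x y := by simp [d_P]
  S_d_right x f := by simp
  S_d_left f x := by simp [P_comm x]
  d_J x y z := by simp [leibniz x y z]
  J_d_right x y f := by simpa [d_P, bracket_d] using P_invariant x y (d f)
  J_d_middle x f z := by simp
  J_d_left f y z := by simp
  J_antisymm_left x y z := by simp
  J_antisymm_right x y z := by simp
  coherence_J w x y z := by simp
  coherence_S_left x y z := by simp
  coherence_S_right x y z := by simp [P_invariant, add_comm]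
  coherence_S_symm x y z := by simp [P_comm x]

end HemistrictOfPairing

namespace TwoPlectic

open VectorField

section Alternating

open ContinuousAlternatingMap

variable {𝕜 : Type*} [NontriviallyNormedField 𝕜] {E : Type*} [NormedAddCommGroup E]
  [NormedSpace 𝕜 E] {F : Type*} [NormedAddCommGroup F] [NormedSpace 𝕜 F] {k : ℕ}

variable (𝕜 E F k) in
/-- `ContinuousAlternatingMap.curryLeft`, which is interior multiplication `α ↦ (v ↦ ι_v α)`, as a
continuous linear map in the form. -/
noncomputable def curryLeftCLM :
    (E [⋀^Fin (k + 1)]→L[𝕜] F) →L[𝕜] E →L[𝕜] E [⋀^Fin k]→L[𝕜] F :=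
  curryLeftLI.toContinuousLinearMap

theorem curryLeft_alternatizeUncurryFin_zero (f : E →L[𝕜] E [⋀^Fin 0]→L[𝕜] F) (v : E) :
    (alternatizeUncurryFin f).curryLeft v = f v := by
  ext u
  simp [alternatizeUncurryFin_apply, Subsingleton.elim u 0]

theorem curryLeft_alternatizeUncurryFin_succ (f : E →L[𝕜] E [⋀^Fin (k + 1)]→L[𝕜] F) (v : E) :
    (alternatizeUncurryFin f).curryLeft v =
      f v - alternatizeUncurryFin ((curryLeftCLM 𝕜 E F k ∘L f).flip v) := by
  ext u
  have h (i : Fin (k + 1)) : i.succ.removeNth (Matrix.vecCons v u) =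
      Matrix.vecCons v (i.removeNth u) := Fin.cons_comp_succ_succAbove ..
  simp [alternatizeUncurryFin_apply, Fin.sum_univ_succ (n := k + 1), pow_succ, sub_eq_add_neg, h,
    curryLeftCLM]

theorem curryLeft_fderivCompContinuousLinearMap_id (α : E [⋀^Fin (k + 1)]→L[𝕜] F)
    (A : E →L[𝕜] E) (w : E) :
    (α.fderivCompContinuousLinearMap (.id 𝕜 E) A).curryLeft w =
      α.curryLeft (A w) + (α.curryLeft w).fderivCompContinuousLinearMap (.id 𝕜 E) A := by
  ext u
  simp only [curryLeft_apply_apply, fderivCompContinuousLinearMap_apply, Fin.sum_univ_succ,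
    ContinuousAlternatingMap.add_apply]
  refine congrArg₂ (· + ·) (congrArg α (funext fun j => ?_))
    (Finset.sum_congr rfl fun i _ => congrArg α (funext fun j => ?_)) <;>
  cases j using Fin.cases <;> simp [Function.update_apply, (Fin.succ_ne_zero _).symm]

theorem alternatizeUncurryFin_curryLeft_comp (α : E [⋀^Fin (k + 1)]→L[𝕜] F) (A : E →L[𝕜] E) :
    alternatizeUncurryFin (α.curryLeft ∘L A) =
      α.fderivCompContinuousLinearMap (.id 𝕜 E) A := by
  rw [fderivCompContinuousLinearMap_eq_alternatizeUncurryFin]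
  rfl

end Alternating

section Model

open ContinuousAlternatingMap

variable {𝕜 : Type*} [NontriviallyNormedField 𝕜] {E : Type*} [NormedAddCommGroup E]
  [NormedSpace 𝕜 E] {F : Type*} [NormedAddCommGroup F] [NormedSpace 𝕜 F] {k : ℕ}
  {V W : E → E} {y : E}

theorem contDiffOn_curryLeft {n : WithTop ℕ∞} {η : E → E [⋀^Fin (k + 1)]→L[𝕜] F} {s : Set E}
    (hη : ContDiffOn 𝕜 n η s) (hV : ContDiffOn 𝕜 n V s) :
    ContDiffOn 𝕜 n (fun z => (η z).curryLeft (V z)) s :=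
  (curryLeftCLM 𝕜 E F k).isBoundedBilinearMap.contDiff.comp₂_contDiffOn hη hV

theorem fderiv_curryLeft {η : E → E [⋀^Fin (k + 1)]→L[𝕜] F} (hη : DifferentiableAt 𝕜 η y)
    (hV : DifferentiableAt 𝕜 V y) :
    fderiv 𝕜 (fun z => (η z).curryLeft (V z)) y =
      (η y).curryLeft ∘L fderiv 𝕜 V y +
        (curryLeftCLM 𝕜 E F k ∘L fderiv 𝕜 η y).flip (V y) :=
  (HasFDerivAt.clm_apply (c := curryLeftCLM 𝕜 E F k ∘ η)
    ((curryLeftCLM 𝕜 E F k).hasFDerivAt.comp y hη.hasFDerivAt) hV.hasFDerivAt).fderiv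

/-- The Lie derivative of a `k`-form `η` along a vector field `V` on a normed space,
`(L_V η)(u₁, …, u_k) = (D_V η)(u₁, …, u_k) + ∑ᵢ η(u₁, …, DV(uᵢ), …, u_k)`. -/
noncomputable def lieDerivForm (V : E → E) (η : E → E [⋀^Fin k]→L[𝕜] F) (y : E) :
    E [⋀^Fin k]→L[𝕜] F :=
  fderiv 𝕜 η y (V y) + (η y).fderivCompContinuousLinearMap (.id 𝕜 E) (fderiv 𝕜 V y)

theorem lieDerivForm_zero (η : E → E [⋀^Fin 0]→L[𝕜] F) :
    lieDerivForm V η y = (extDeriv η y).curryLeft (V y) := by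
  rw [extDeriv, curryLeft_alternatizeUncurryFin_zero, lieDerivForm,
    fderivCompContinuousLinearMap_of_isEmpty, Pi.zero_apply, Pi.zero_apply,
    zero_apply, add_zero]

theorem lieDerivForm_succ {η : E → E [⋀^Fin (k + 1)]→L[𝕜] F} (hη : DifferentiableAt 𝕜 η y)
    (hV : DifferentiableAt 𝕜 V y) :
    lieDerivForm V η y =
      (extDeriv η y).curryLeft (V y) + extDeriv (fun z => (η z).curryLeft (V z)) y := by
  rw [extDeriv, extDeriv, curryLeft_alternatizeUncurryFin_succ, fderiv_curryLeft hη hV,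
    alternatizeUncurryFin_add, alternatizeUncurryFin_curryLeft_comp, lieDerivForm]
  abel

theorem lieDerivForm_curryLeft {η : E → E [⋀^Fin (k + 1)]→L[𝕜] F} (hη : DifferentiableAt 𝕜 η y)
    (hW : DifferentiableAt 𝕜 W y) :
    lieDerivForm V (fun z => (η z).curryLeft (W z)) y =
      (η y).curryLeft (lieBracket 𝕜 V W y) + (lieDerivForm V η y).curryLeft (W y) := by
  have h := curryLeft_fderivCompContinuousLinearMap_id (η y) (fderiv 𝕜 V y) (W y)
  simp only [lieDerivForm, fderiv_curryLeft hη hW, lieBracket, curryLeft_add, map_sub,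
    _root_.add_apply, h]
  change (η y).curryLeft (fderiv 𝕜 W y (V y)) + (fderiv 𝕜 η y (V y)).curryLeft (W y) + _ = _
  abel

end Model

theorem lieDerivForm_eq_lieDerivModel {E : Type*} [NormedAddCommGroup E] [NormedSpace ℝ E]
    (V : E → E) (η : E → E [⋀^Fin 1]→L[ℝ] ℝ) (y : E) :
    lieDerivForm V η y = lieDerivModel V η y := by
  ext u
  simp [lieDerivForm, lieDerivModel, Function.comp_def, Subsingleton.elim _ (0 : Fin 1)]

/-- The space of smooth vector fields on `X`. -/
abbrev 𝔛 {E : Type*} [NormedAddCommGroup E] [NormedSpace ℝ E] {H : Type*} [TopologicalSpace H]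
    (I : ModelWithCorners ℝ E H) (X : Type*) [TopologicalSpace X] [ChartedSpace H X]
    [IsManifold I ∞ X] : Type _ :=
  Cₛ^∞⟮I; E, (TangentSpace I : X → Type _)⟯

section Charts

open ContinuousAlternatingMap

variable {E : Type*} [NormedAddCommGroup E] [NormedSpace ℝ E]
  {H : Type*} [TopologicalSpace H] {I : ModelWithCorners ℝ E H}
  {X : Type*} [TopologicalSpace X] [ChartedSpace H X] {k : ℕ}

section Boundaryless

variable [I.Boundaryless]

theorem chartRep_contDiffAt (η : Ω I X k) {x₀ : X} {y : E}
    (hy : y ∈ (extChartAt I x₀).target) : ContDiffAt ℝ ∞ (chartRep I η.1 x₀) y :=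
  (η.2 x₀).contDiffAt ((isOpen_extChartAt_target x₀).mem_nhds hy)

theorem chartRepField_eq_mpullback (v : ∀ x : X, TangentSpace I x) (x₀ : X) :
    chartRepField I v x₀ = mpullback 𝓘(ℝ, E) I (extChartAt I x₀).symm v := by
  ext y
  rw [chartRepField, I.range_eq_univ, mpullbackWithin_univ]

end Boundaryless

variable [IsManifold I ∞ X]

theorem mfderivWithin_chartRepField (v : ∀ x : X, TangentSpace I x) {x₀ : X} {y : E}
    (hy : y ∈ (extChartAt I x₀).target) :
    mfderivWithin 𝓘(ℝ, E) I (extChartAt I x₀).symm (Set.range I) y (chartRepField I v x₀ y : E) =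
      v ((extChartAt I x₀).symm y) :=
  congrArg (fun L : TangentSpace I ((extChartAt I x₀).symm y) →L[ℝ] _ => L (v _))
    (isInvertible_mfderivWithin_extChartAt_symm hy).self_comp_inverse

theorem chartRep_interiorProduct (v : ∀ x : X, TangentSpace I x)
    (η : ∀ x : X, TangentSpace I x [⋀^Fin (k + 1)]→L[ℝ] ℝ) {x₀ : X} {y : E}
    (hy : y ∈ (extChartAt I x₀).target) :
    chartRep I (fun x => interiorProduct I (v x) (η x)) x₀ y =
      (chartRep I η x₀ y).curryLeft (chartRepField I v x₀ y) := by
  ext u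
  refine congrArg (η ((extChartAt I x₀).symm y)) (funext fun i => ?_)
  cases i using Fin.cases with
  | zero => exact (mfderivWithin_chartRepField v hy).symm
  | succ j => rfl

theorem chartRep_compContinuousLinearMap (η : ∀ x : X, TangentSpace I x [⋀^Fin k]→L[ℝ] ℝ)
    {x₀ x : X} (hx : x ∈ (extChartAt I x₀).source) :
    (chartRep I η x₀ (extChartAt I x₀ x)).compContinuousLinearMap
      (mfderiv I 𝓘(ℝ, E) (extChartAt I x₀) x) = η x := by
  obtain ⟨y, hy, rfl⟩ : ∃ y ∈ (extChartAt I x₀).target, (extChartAt I x₀).symm y = x :=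
    ⟨_, (extChartAt I x₀).map_source hx, (extChartAt I x₀).left_inv hx⟩
  rw [(extChartAt I x₀).right_inv hy]
  ext u
  refine congrArg (η ((extChartAt I x₀).symm y)) (funext fun i => ?_)
  exact congrArg (fun L => L (u i)) (mfderivWithin_extChartAt_symm_comp_mfderiv_extChartAt hy)

theorem eq_of_chartRep_eq {η θ : ∀ x : X, TangentSpace I x [⋀^Fin k]→L[ℝ] ℝ} {x : X}
    (h : chartRep I η x (extChartAt I x x) = chartRep I θ x (extChartAt I x x)) : η x = θ x := by
  rw [← chartRep_compContinuousLinearMap η (mem_extChartAt_source x),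
    ← chartRep_compContinuousLinearMap θ (mem_extChartAt_source x), h]

theorem Ω_ext {η θ : Ω I X k} (h : ∀ x : X, ∀ y ∈ (extChartAt I x).target,
    chartRep I η.1 x y = chartRep I θ.1 x y) : η = θ :=
  Subtype.ext (funext fun x => eq_of_chartRep_eq (h x _ (mem_extChartAt_target x)))

variable [I.Boundaryless]

theorem contMDiffAt_extChartAt_symm {x₀ : X} {y : E} (hy : y ∈ (extChartAt I x₀).target) :
    ContMDiffAt 𝓘(ℝ, E) I ∞ (extChartAt I x₀).symm y :=
  (contMDiffOn_extChartAt_symm x₀).contMDiffAt ((isOpen_extChartAt_target x₀).mem_nhds hy)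

theorem fderiv_extChartAt_comp_symm {x₀ x₁ : X} {y : E} (hy : y ∈ (extChartAt I x₀).target)
    (hy' : (extChartAt I x₀).symm y ∈ (extChartAt I x₁).source) :
    fderiv ℝ (extChartAt I x₁ ∘ (extChartAt I x₀).symm) y =
      (mfderiv I 𝓘(ℝ, E) (extChartAt I x₁) ((extChartAt I x₀).symm y)).comp
        (mfderivWithin 𝓘(ℝ, E) I (extChartAt I x₀).symm (Set.range I) y) := by
  rw [← mfderiv_eq_fderiv, I.range_eq_univ, mfderivWithin_univ]
  exact mfderiv_comp y (mdifferentiableAt_extChartAt (by simpa using hy'))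
    ((contMDiffAt_extChartAt_symm hy).mdifferentiableAt (by simp))

theorem chartRep_eq_compContinuousLinearMap (η : ∀ x : X, TangentSpace I x [⋀^Fin k]→L[ℝ] ℝ)
    {x₀ x₁ : X} {y : E} (hy : y ∈ (extChartAt I x₀).target)
    (hy' : (extChartAt I x₀).symm y ∈ (extChartAt I x₁).source) :
    chartRep I η x₀ y =
      (chartRep I η x₁ (extChartAt I x₁ ((extChartAt I x₀).symm y))).compContinuousLinearMap
        (fderiv ℝ (extChartAt I x₁ ∘ (extChartAt I x₀).symm) y) := by
  rw [fderiv_extChartAt_comp_symm hy hy', chartRep, ← chartRep_compContinuousLinearMap η hy']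
  rfl

theorem minSmoothness_two_le : minSmoothness ℝ 2 ≤ ∞ := by
  rw [minSmoothness_of_isRCLikeNormedField]
  exact WithTop.coe_le_coe.2 le_top

theorem chartRep_extDerivAt (η : Ω I X k) {x₀ : X} {y : E} (hy : y ∈ (extChartAt I x₀).target) :
    chartRep I (extDerivAt I η.1) x₀ y = extDeriv (chartRep I η.1 x₀) y := by
  set x := (extChartAt I x₀).symm y
  let τ : E → E := extChartAt I x ∘ (extChartAt I x₀).symm
  have hτ : ContDiffAt ℝ ∞ τ y :=
    (contMDiffAt_extChartAt.comp y (contMDiffAt_extChartAt_symm hy)).contDiffAt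
  have h_transition : chartRep I η.1 x₀ =ᶠ[nhds y] fun z =>
      (chartRep I η.1 x (τ z)).compContinuousLinearMap (fderiv ℝ τ z) := by
    filter_upwards [(isOpen_extChartAt_target x₀).mem_nhds hy,
      (contMDiffAt_extChartAt_symm hy).continuousAt.preimage_mem_nhds
        (extChartAt_source_mem_nhds (I := I) x)] with z hz hz'
    exact chartRep_eq_compContinuousLinearMap η.1 hz hz'
  have hη : DifferentiableAt ℝ (chartRep I η.1 x) (τ y) := chartRep_differentiableAt I η x
  rw [h_transition.extDeriv_eq, extDeriv_pullback hη hτ minSmoothness_two_le,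
    fderiv_extChartAt_comp_symm hy (mem_extChartAt_source x)]
  rfl

theorem extDerivAt_mem (η : Ω I X k) : extDerivAt I η.1 ∈ Ω I X (k + 1) := by
  intro x₀
  have h_uncurry : ContDiff ℝ ∞ (alternatizeUncurryFinCLM (n := k) ℝ E ℝ) :=
    ContinuousLinearMap.contDiff (𝕜 := ℝ) _
  have h_fderiv : ContDiffOn ℝ ∞ (fderiv ℝ (chartRep I η.1 x₀)) (extChartAt I x₀).target :=
    (η.2 x₀).fderiv_of_isOpen (isOpen_extChartAt_target x₀) (by simp)
  exact (h_uncurry.comp_contDiffOn h_fderiv).congr fun _ hy => chartRep_extDerivAt η hy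

variable [CompleteSpace E]

theorem contDiffOn_chartRepField (v : 𝔛 I X) (x₀ : X) :
    ContDiffOn ℝ ∞ (chartRepField I v x₀) (extChartAt I x₀).target := by
  intro y hy
  have hinv : (mfderiv 𝓘(ℝ, E) I (extChartAt I x₀).symm y).IsInvertible := by
    rw [← mfderivWithin_univ, ← I.range_eq_univ]
    exact isInvertible_mfderivWithin_extChartAt_symm hy
  rw [chartRepField_eq_mpullback]
  exact (contMDiffAt_vectorSpace_iff_contDiffAt.1
    (ContMDiffAt.mpullback_vectorField_preimage (n := ∞) (v.contMDiff _)
      (contMDiffAt_extChartAt_symm hy) hinv (by simp))).contDiffWithinAt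

theorem differentiableAt_chartRepField (v : 𝔛 I X) {x₀ : X} {y : E}
    (hy : y ∈ (extChartAt I x₀).target) : DifferentiableAt ℝ (chartRepField I v x₀) y :=
  ((contDiffOn_chartRepField v x₀).contDiffAt
    ((isOpen_extChartAt_target x₀).mem_nhds hy)).differentiableAt (by simp)

theorem chartRepField_mlieBracket (v w : 𝔛 I X) {x₀ : X} {y : E}
    (hy : y ∈ (extChartAt I x₀).target) :
    chartRepField I (mlieBracket I v w) x₀ y =
      lieBracket ℝ (chartRepField I v x₀) (chartRepField I w x₀) y := by
  have : IsManifold I (minSmoothness ℝ 2) X := IsManifold.of_le minSmoothness_two_le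
  rw [chartRepField_eq_mpullback, chartRepField_eq_mpullback, chartRepField_eq_mpullback,
    mpullback_mlieBracket ((v.contMDiff _).mdifferentiableAt (by simp))
      ((w.contMDiff _).mdifferentiableAt (by simp)) (contMDiffAt_extChartAt_symm hy)
      minSmoothness_two_le,
    ← mlieBracketWithin_univ, mlieBracketWithin_eq_lieBracketWithin]
  exact congrFun lieBracketWithin_univ y

theorem interiorProduct_mem (v : 𝔛 I X) (η : Ω I X (k + 1)) :
    (fun x => interiorProduct I (v x) (η.1 x)) ∈ Ω I X k := fun x₀ =>
  (contDiffOn_curryLeft (η.2 x₀) (contDiffOn_chartRepField v x₀)).congr fun _ hy =>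
    chartRep_interiorProduct v η.1 hy

end Charts

section CartanCalculus

variable {E : Type*} [NormedAddCommGroup E] [NormedSpace ℝ E]
  {H : Type*} [TopologicalSpace H] {I : ModelWithCorners ℝ E H} [I.Boundaryless]
  {X : Type*} [TopologicalSpace X] [ChartedSpace H X] [IsManifold I ∞ X] {k : ℕ}

/-- Shortcut instance: without it `rw` and `simp` do not recognise the negation of forms. -/
noncomputable instance : AddCommGroup (Ω I X k) :=
  (Ω I X k).addCommGroup

/-- The exterior derivative on smooth `k`-forms. -/
noncomputable def extDer : Ω I X k →ₗ[ℝ] Ω I X (k + 1) where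
  toFun η := ⟨extDerivAt I η.1, extDerivAt_mem η⟩
  map_add' η θ := Subtype.ext (funext (extDerivAt_add I η θ))
  map_smul' c η := Subtype.ext (funext (extDerivAt_smul I c η))

theorem extDer_extDer (η : Ω I X k) : extDer (extDer η) = 0 := by
  refine Ω_ext fun x₀ y hy => ?_
  have h_eventually : chartRep I (extDer η).1 x₀ =ᶠ[nhds y] extDeriv (chartRep I η.1 x₀) := by
    filter_upwards [(isOpen_extChartAt_target x₀).mem_nhds hy] with z hz
    exact chartRep_extDerivAt η hz
  calc chartRep I (extDer (extDer η)).1 x₀ y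
      = extDeriv (chartRep I (extDer η).1 x₀) y := chartRep_extDerivAt (extDer η) hy
    _ = extDeriv (extDeriv (chartRep I η.1 x₀)) y := h_eventually.extDeriv_eq
    _ = 0 := extDeriv_extDeriv_apply (chartRep_contDiffAt η hy) minSmoothness_two_le

variable [CompleteSpace E]

/-- The Lie bracket of smooth vector fields. -/
noncomputable def fieldBracket (v w : 𝔛 I X) : 𝔛 I X where
  toFun := mlieBracket I v w
  contMDiff_toFun := by
    have : IsManifold I (minSmoothness ℝ 2) X := IsManifold.of_le minSmoothness_two_le
    have : IsManifold I (((⊤ : ℕ∞) : WithTop ℕ∞) + 1) X := ‹IsManifold I ∞ X›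
    exact ContDiff.mlieBracket_vectorField (m := ⊤) (n := ⊤) v.contMDiff w.contMDiff (by simp)

/-- Interior multiplication `ι_v η` of smooth forms by smooth vector fields. -/
noncomputable def ι : 𝔛 I X →ₗ[ℝ] Ω I X (k + 1) →ₗ[ℝ] Ω I X k :=
  LinearMap.mk₂ ℝ (fun v η => ⟨fun x => interiorProduct I (v x) (η.1 x), interiorProduct_mem v η⟩)
    (fun v w η => Subtype.ext (funext fun x => interiorProduct_add I (v x) (w x) (η.1 x)))
    (fun c v η => Subtype.ext (funext fun x => interiorProduct_smul I c (v x) (η.1 x)))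
    (fun _ _ _ => rfl) (fun _ _ _ => rfl)

theorem ι_self (v : 𝔛 I X) (η : Ω I X (k + 2)) : ι v (ι v η) = 0 :=
  Subtype.ext <| funext fun x => by
    ext u
    exact (η.1 x).map_eq_zero_of_eq (i := 0) (j := 1)
      (Matrix.vecCons (v x) (Matrix.vecCons (v x) u)) rfl Fin.zero_ne_one

theorem ι_swap (v w : 𝔛 I X) (η : Ω I X (k + 2)) : ι v (ι w η) = -ι w (ι v η) := by
  have h : ι v (ι w η) + ι w (ι v η) = 0 := by simpa [ι_self] using ι_self (v + w) η
  exact eq_neg_of_add_eq_zero_left h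

theorem chartRep_ι_eventuallyEq (v : 𝔛 I X) (η : Ω I X (k + 1)) {x₀ : X} {y : E}
    (hy : y ∈ (extChartAt I x₀).target) :
    chartRep I (ι v η).1 x₀ =ᶠ[nhds y]
      fun z => (chartRep I η.1 x₀ z).curryLeft (chartRepField I v x₀ z) := by
  filter_upwards [(isOpen_extChartAt_target x₀).mem_nhds hy] with z hz
  exact chartRep_interiorProduct v η.1 hz

/-- The Lie derivative `L_v` of smooth forms, defined by Cartan's formula `L_v = ι_v d + d ι_v`. -/
noncomputable def lie : ∀ {k : ℕ}, 𝔛 I X →ₗ[ℝ] Ω I X k →ₗ[ℝ] Ω I X k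
  | 0 => ι.compl₂ extDer
  | _ + 1 => ι.compl₂ extDer + ι.compr₂ extDer

theorem lie_zeroForm (v : 𝔛 I X) (η : Ω I X 0) : lie v η = ι v (extDer η) := rfl

theorem lie_succ (v : 𝔛 I X) (η : Ω I X (k + 1)) :
    lie v η = ι v (extDer η) + extDer (ι v η) := rfl

theorem lie_extDer (v : 𝔛 I X) (η : Ω I X k) : lie v (extDer η) = extDer (lie v η) := by
  cases k <;> simp [lie_succ, lie_zeroForm, extDer_extDer]

theorem chartRep_lie (v : 𝔛 I X) (η : Ω I X k) {x₀ : X} {y : E}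
    (hy : y ∈ (extChartAt I x₀).target) :
    chartRep I (lie v η).1 x₀ y = lieDerivForm (chartRepField I v x₀) (chartRep I η.1 x₀) y := by
  have h_ι_d : chartRep I (ι v (extDer η)).1 x₀ y =
      (extDeriv (chartRep I η.1 x₀) y).curryLeft (chartRepField I v x₀ y) := by
    rw [← chartRep_extDerivAt η hy]
    exact chartRep_interiorProduct v _ hy
  cases k with
  | zero => rw [lieDerivForm_zero, ← h_ι_d, lie_zeroForm]
  | succ k =>
    have h_d_ι : chartRep I (extDer (ι v η)).1 x₀ y =
        extDeriv (fun z => (chartRep I η.1 x₀ z).curryLeft (chartRepField I v x₀ z)) y :=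
      (chartRep_extDerivAt (ι v η) hy).trans (chartRep_ι_eventuallyEq v η hy).extDeriv_eq
    rw [lieDerivForm_succ ((chartRep_contDiffAt η hy).differentiableAt (by simp))
      (differentiableAt_chartRepField v hy), ← h_ι_d, ← h_d_ι, lie_succ]
    rfl

theorem lie_ι (v w : 𝔛 I X) (η : Ω I X (k + 1)) :
    lie v (ι w η) = ι (fieldBracket v w) η + ι w (lie v η) := by
  refine Ω_ext fun x₀ y hy => ?_
  let V := chartRepField I v x₀
  let W := chartRepField I w x₀
  let α := chartRep I η.1 x₀
  have h_eventually := chartRep_ι_eventuallyEq w η hy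
  calc chartRep I (lie v (ι w η)).1 x₀ y
      = lieDerivForm V (fun z => (α z).curryLeft (W z)) y := by
        rw [chartRep_lie v _ hy, lieDerivForm, h_eventually.fderiv_eq, h_eventually.eq_of_nhds]
        rfl
    _ = (α y).curryLeft (lieBracket ℝ V W y) + (lieDerivForm V α y).curryLeft (W y) :=
        lieDerivForm_curryLeft ((chartRep_contDiffAt η hy).differentiableAt (by simp))
          (differentiableAt_chartRepField w hy)
    _ = chartRep I (ι (fieldBracket v w) η).1 x₀ y + chartRep I (ι w (lie v η)).1 x₀ y := by
        rw [← chartRepField_mlieBracket v w hy, ← chartRep_lie v η hy]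
        exact congrArg₂ (· + ·) (chartRep_interiorProduct _ η.1 hy).symm
          (chartRep_interiorProduct w _ hy).symm

theorem lie_lie (v w : 𝔛 I X) (η : Ω I X k) :
    lie v (lie w η) = lie (fieldBracket v w) η + lie w (lie v η) := by
  cases k with
  | zero => rw [lie_zeroForm w, lie_ι, lie_extDer]; rfl
  | succ k =>
    rw [lie_succ w η, map_add, lie_extDer, lie_ι, lie_ι, lie_extDer, map_add,
      lie_succ (fieldBracket v w), lie_succ w]
    abel

theorem lie_eq_lieDeriv (v : 𝔛 I X) (η : Ω I X 1) (x : X) :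
    (lie v η).1 x = lieDeriv I v η.1 x := by
  rw [lieDeriv, ← lieDerivForm_eq_lieDerivModel, ← chartRep_lie v η (mem_extChartAt_target x),
    chartRep_compContinuousLinearMap _ (mem_extChartAt_source x)]

end CartanCalculus

section ZeroForms

open ContinuousAlternatingMap

variable {E : Type*} [NormedAddCommGroup E] [NormedSpace ℝ E]
  {H : Type*} [TopologicalSpace H] {I : ModelWithCorners ℝ E H} [I.Boundaryless]
  {X : Type*} [TopologicalSpace X] [ChartedSpace H X] [IsManifold I ∞ X]

theorem contMDiff_iff_contDiffOn_comp_extChartAt_symm {f : X → ℝ} :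
    ContMDiff I 𝓘(ℝ, ℝ) ∞ f ↔
      ∀ x₀ : X, ContDiffOn ℝ ∞ (f ∘ (extChartAt I x₀).symm) (extChartAt I x₀).target := by
  refine ⟨fun h x₀ y hy =>
    (ContMDiffAt.comp y (h _) (contMDiffAt_extChartAt_symm hy)).contDiffAt.contDiffWithinAt,
    fun h x => ?_⟩
  have h_comp : ContMDiffAt I 𝓘(ℝ, ℝ) ∞ ((f ∘ (extChartAt I x).symm) ∘ extChartAt I x) x :=
    ContMDiffAt.comp x ((h x).contDiffAt (extChartAt_target_mem_nhds x)).contMDiffAt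
      contMDiffAt_extChartAt
  refine h_comp.congr_of_eventuallyEq ?_
  filter_upwards [extChartAt_source_mem_nhds (I := I) x] with z hz
  exact congrArg f ((extChartAt I x).left_inv hz).symm

variable (I X) in
/-- Smooth functions are the smooth `0`-forms. -/
noncomputable def zeroFormEquiv : C^∞⟮I, X; ℝ⟯ ≃ₗ[ℝ] Ω I X 0 where
  toFun f := ⟨fun x => constOfIsEmpty ℝ (TangentSpace I x) (Fin 0) (f x), fun x₀ =>
    (constOfIsEmptyLIE ℝ E ℝ (Fin 0)).contDiff.comp_contDiffOn
      (contMDiff_iff_contDiffOn_comp_extChartAt_symm.1 f.contMDiff x₀)⟩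
  map_add' _ _ := rfl
  map_smul' _ _ := rfl
  invFun η := ⟨fun x => η.1 x ![], contMDiff_iff_contDiffOn_comp_extChartAt_symm.2 fun x₀ =>
    ((constOfIsEmptyLIE ℝ E ℝ (Fin 0)).symm.contDiff.comp_contDiffOn (η.2 x₀)).congr
      fun _ _ => congrArg (η.1 _) (Subsingleton.elim _ _)⟩
  left_inv _ := rfl
  right_inv η := Subtype.ext <| funext fun x => by
    ext u
    exact congrArg (η.1 x) (Subsingleton.elim _ _)

theorem extDerivAt_zeroFormEquiv (f : C^∞⟮I, X; ℝ⟯) (x : X) :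
    extDerivAt I (zeroFormEquiv I X f).1 x = dFun I f x := by
  refine eq_of_chartRep_eq (η := extDerivAt I _) (θ := dFun I f) ?_
  have hx := mem_extChartAt_target (I := I) x
  have h_mfderiv : mfderiv 𝓘(ℝ, E) 𝓘(ℝ, ℝ) (f ∘ (extChartAt I x).symm) (extChartAt I x x) = _ :=
    mfderiv_comp _ (f.contMDiff.mdifferentiable (by simp) _)
      ((contMDiffAt_extChartAt_symm hx).mdifferentiableAt (by simp))
  rw [chartRep_extDerivAt _ hx]
  refine (extDeriv_constOfIsEmpty (f ∘ (extChartAt I x).symm) (extChartAt I x x)).trans ?_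
  rw [← mfderiv_eq_fderiv, h_mfderiv, chartRep, I.range_eq_univ, mfderivWithin_univ]
  rfl

end ZeroForms

section Hamiltonian

variable {E : Type*} [NormedAddCommGroup E] [NormedSpace ℝ E]
  {H : Type*} [TopologicalSpace H] {I : ModelWithCorners ℝ E H} [I.Boundaryless]
  {X : Type*} [TopologicalSpace X] [ChartedSpace H X] [IsManifold I ∞ X] {ω₃ : Ω I X 3}

/-- The inclusion `Ham(X) → Ω¹(X)`. -/
noncomputable def toForm : Ham ω₃ →ₗ[ℝ] Ω I X 1 :=
  Submodule.inclusion fun _ h => h.1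

theorem toForm_injective : Function.Injective (toForm : Ham ω₃ →ₗ[ℝ] Ω I X 1) :=
  Submodule.inclusion_injective _

variable [CompleteSpace E]

theorem isHamiltonianField_iff {η : Ω I X 1} {v : 𝔛 I X} :
    IsHamiltonianField ω₃ η.1 v ↔ extDer η = -ι v ω₃ :=
  ⟨fun h => Subtype.ext (funext h), fun h x => congrFun (congrArg Subtype.val h) x⟩

theorem extDer_toForm (F : Ham ω₃) : extDer (toForm F) = -ι (hamField F) ω₃ :=
  isHamiltonianField_iff.1 (hamField_spec F)

theorem hamField_eq_of_extDer_toForm (hω : IsTwoPlectic ω₃) {F : Ham ω₃} {v : 𝔛 I X}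
    (h : extDer (toForm F) = -ι v ω₃) : hamField F = v :=
  (hamField_unique hω F v (isHamiltonianField_iff.2 h)).symm

/-- The assignment `F ↦ v_F` as a linear map; nondegeneracy makes it one. -/
noncomputable def hamFieldₗ (hω : IsTwoPlectic ω₃) : Ham ω₃ →ₗ[ℝ] 𝔛 I X where
  toFun := hamField
  map_add' F G := hamField_eq_of_extDer_toForm hω <| by
    simp only [map_add, extDer_toForm, LinearMap.add_apply, neg_add]
  map_smul' c F := hamField_eq_of_extDer_toForm hω <| by
    simp only [map_smul, extDer_toForm, LinearMap.smul_apply, smul_neg, RingHom.id_apply]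

variable (ω₃) in
/-- The exterior derivative `C^∞(X) → Ham(X)`. -/
noncomputable def dHam : C^∞⟮I, X; ℝ⟯ →ₗ[ℝ] Ham ω₃ :=
  ((Ω I X 1).subtype ∘ₗ extDer ∘ₗ (zeroFormEquiv I X).toLinearMap).codRestrict (Ham ω₃) fun f =>
    ⟨Subtype.property _, 0, isHamiltonianField_iff.2 <| by simp [extDer_extDer]⟩

theorem toForm_dHam (f : C^∞⟮I, X; ℝ⟯) :
    toForm (dHam ω₃ f) = extDer (zeroFormEquiv I X f) := rfl

theorem dHam_apply (f : C^∞⟮I, X; ℝ⟯) (x : X) : (dHam ω₃ f).1 x = dFun I f x :=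
  extDerivAt_zeroFormEquiv f x

theorem hamField_dHam (hω : IsTwoPlectic ω₃) (f : C^∞⟮I, X; ℝ⟯) : hamField (dHam ω₃ f) = 0 :=
  hamField_eq_of_extDer_toForm hω <| by simp [toForm_dHam, extDer_extDer]

theorem lie_hamField (hω : IsTwoPlectic ω₃) (F : Ham ω₃) : lie (hamField F) ω₃ = 0 := by
  have h_closed : extDer ω₃ = 0 := Subtype.ext (funext hω.closed)
  have h_exact : ι (hamField F) ω₃ = -extDer (toForm F) := by rw [extDer_toForm, neg_neg]
  rw [lie_succ, h_closed, h_exact, map_neg, extDer_extDer, map_zero, neg_zero, add_zero]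

theorem extDer_lie_hamField (hω : IsTwoPlectic ω₃) (F G : Ham ω₃) :
    extDer (lie (hamField F) (toForm G)) = -ι (fieldBracket (hamField F) (hamField G)) ω₃ := by
  rw [← lie_extDer, extDer_toForm, map_neg, lie_ι, lie_hamField hω, map_zero, add_zero]

/-- The hemi-bracket `{F, G} = L_{v_F} G`. -/
noncomputable def hemiBracket (hω : IsTwoPlectic ω₃) : Ham ω₃ →ₗ[ℝ] Ham ω₃ →ₗ[ℝ] Ham ω₃ :=
  let L : Ham ω₃ →ₗ[ℝ] Ham ω₃ →ₗ[ℝ] Ω I X 1 := (lie ∘ₗ hamFieldₗ hω).compl₂ toForm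
  LinearMap.mk₂ ℝ
    (fun F G => ⟨(L F G).1, (L F G).2, _, isHamiltonianField_iff.2 (extDer_lie_hamField hω F G)⟩)
    (fun F G K => toForm_injective (L.map_add₂ F G K))
    (fun c F G => toForm_injective (L.map_smul₂ c F G))
    (fun F G K => toForm_injective ((L F).map_add G K))
    (fun c F G => toForm_injective ((L F).map_smul c G))

theorem toForm_hemiBracket (hω : IsTwoPlectic ω₃) (F G : Ham ω₃) :
    toForm (hemiBracket hω F G) = lie (hamField F) (toForm G) := rfl

theorem hamField_hemiBracket (hω : IsTwoPlectic ω₃) (F G : Ham ω₃) :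
    hamField (hemiBracket hω F G) = fieldBracket (hamField F) (hamField G) :=
  hamField_eq_of_extDer_toForm hω (extDer_lie_hamField hω F G)

/-- The symmetric pairing `(F, G) ↦ ι_{v_F} G + ι_{v_G} F`, the negative of the alternator. -/
noncomputable def hamPairing (hω : IsTwoPlectic ω₃) :
    Ham ω₃ →ₗ[ℝ] Ham ω₃ →ₗ[ℝ] C^∞⟮I, X; ℝ⟯ :=
  let contraction := (ι ∘ₗ hamFieldₗ hω).compl₂ toForm
  (contraction + contraction.flip).compr₂ (zeroFormEquiv I X).symm.toLinearMap

theorem zeroFormEquiv_hamPairing (hω : IsTwoPlectic ω₃) (F G : Ham ω₃) :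
    zeroFormEquiv I X (hamPairing hω F G) =
      ι (hamField F) (toForm G) + ι (hamField G) (toForm F) :=
  (zeroFormEquiv I X).apply_symm_apply _

theorem hamPairing_apply (hω : IsTwoPlectic ω₃) (F G : Ham ω₃) (x : X) :
    hamPairing hω F G x = pairing I (hamField F x) (G.1 x) + pairing I (hamField G x) (F.1 x) :=
  rfl

theorem hamPairing_comm (hω : IsTwoPlectic ω₃) (F G : Ham ω₃) :
    hamPairing hω F G = hamPairing hω G F := by
  apply (zeroFormEquiv I X).injective
  rw [zeroFormEquiv_hamPairing, zeroFormEquiv_hamPairing, add_comm]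

theorem hamPairing_dHam_dHam (hω : IsTwoPlectic ω₃) (f g : C^∞⟮I, X; ℝ⟯) :
    hamPairing hω (dHam ω₃ f) (dHam ω₃ g) = 0 := by
  apply (zeroFormEquiv I X).injective
  simp [zeroFormEquiv_hamPairing, hamField_dHam hω]

theorem hemiBracket_dHam (hω : IsTwoPlectic ω₃) (f : C^∞⟮I, X; ℝ⟯) (F : Ham ω₃) :
    hemiBracket hω (dHam ω₃ f) F = 0 := by
  apply toForm_injective
  simp [toForm_hemiBracket, hamField_dHam hω]

theorem dHam_hamPairing (hω : IsTwoPlectic ω₃) (F G : Ham ω₃) :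
    dHam ω₃ (hamPairing hω F G) = hemiBracket hω F G + hemiBracket hω G F := by
  apply toForm_injective
  have h_swap : ι (hamField F) (extDer (toForm G)) + ι (hamField G) (extDer (toForm F)) = 0 := by
    rw [extDer_toForm, extDer_toForm, map_neg, map_neg, ι_swap, neg_neg, add_neg_cancel]
  rw [toForm_dHam, zeroFormEquiv_hamPairing, map_add, map_add, toForm_hemiBracket,
    toForm_hemiBracket, lie_succ, lie_succ, add_add_add_comm, h_swap]
  exact (zero_add _).symm

theorem hemiBracket_leibniz (hω : IsTwoPlectic ω₃) (F G K : Ham ω₃) :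
    hemiBracket hω F (hemiBracket hω G K) =
      hemiBracket hω (hemiBracket hω F G) K + hemiBracket hω G (hemiBracket hω F K) := by
  apply toForm_injective
  simp only [map_add, toForm_hemiBracket, hamField_hemiBracket]
  exact lie_lie ..

theorem hamPairing_invariant (hω : IsTwoPlectic ω₃) (F G K : Ham ω₃) :
    hamPairing hω F (dHam ω₃ (hamPairing hω G K)) =
      hamPairing hω (hemiBracket hω F G) K + hamPairing hω G (hemiBracket hω F K) := by
  apply (zeroFormEquiv I X).injective
  rw [zeroFormEquiv_hamPairing, hamField_dHam hω, toForm_dHam, ← lie_zeroForm,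
    zeroFormEquiv_hamPairing, map_add, lie_ι, lie_ι, map_add, zeroFormEquiv_hamPairing,
    zeroFormEquiv_hamPairing]
  simp only [toForm_hemiBracket, hamField_hemiBracket, map_zero, LinearMap.zero_apply]
  abel

theorem hamPairing_dHam_apply (hω : IsTwoPlectic ω₃) (F : Ham ω₃) (f : C^∞⟮I, X; ℝ⟯) (x : X) :
    hamPairing hω F (dHam ω₃ f) x = lieDerivFun I (hamField F) f x := by
  have h_zero : pairing I (0 : TangentSpace I x) (F.1 x) = 0 := (F.1 x).map_coord_zero 0 rfl
  rw [hamPairing_apply, hamField_dHam hω, dHam_apply]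
  exact add_eq_left.2 h_zero

/-- The Lie 2-algebra `L(X, ω)_h`. -/
noncomputable def hemistrictLie2Algebra (hω : IsTwoPlectic ω₃) :
    Lie2Algebra ℝ (Ham ω₃) C^∞⟮I, X; ℝ⟯ :=
  .hemistrictOfPairing (dHam ω₃) (hemiBracket hω) (hamPairing hω) (hamPairing_comm hω)
    (hamPairing_dHam_dHam hω) (hemiBracket_dHam hω) (dHam_hamPairing hω) (hemiBracket_leibniz hω)
    (hamPairing_invariant hω)

end Hamiltonian

end TwoPlectic

open TwoPlectic in
theorem theorem4p3_general {E : Type*} [NormedAddCommGroup E] [NormedSpace ℝ E] [CompleteSpace E]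
    {H : Type*} [TopologicalSpace H] (I : ModelWithCorners ℝ E H) [I.Boundaryless]
    {X : Type*} [TopologicalSpace X] [ChartedSpace H X] [IsManifold I ∞ X]
    (ω₃ : Ω I X 3) (hω : IsTwoPlectic ω₃) :
    ∃ L : Lie2Algebra ℝ (Ham ω₃) C^∞⟮I, X; ℝ⟯,
      (∀ (f : C^∞⟮I, X; ℝ⟯) (x : X), (L.d f).1 x = dFun I f x) ∧
      (∀ (F G : Ham ω₃) (x : X), (L.bracket F G).1 x = lieDeriv I (hamField F) G.1 x) ∧
      (∀ (F : Ham ω₃) (f : C^∞⟮I, X; ℝ⟯) (x : X),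
        L.bracket₀₁ F f x = lieDerivFun I (hamField F) f x) ∧
      (∀ (f : C^∞⟮I, X; ℝ⟯) (F : Ham ω₃), L.bracket₁₀ f F = 0) ∧
      (∀ (F G : Ham ω₃) (x : X), L.S F G x =
        -(pairing I (hamField F x) (G.1 x) + pairing I (hamField G x) (F.1 x))) ∧
      L.IsHemistrict :=
  ⟨hemistrictLie2Algebra hω, dHam_apply, fun F G => lie_eq_lieDeriv (hamField F) (toForm G),
    hamPairing_dHam_apply hω, fun _ _ => rfl,
    fun F G x => congrArg Neg.neg (hamPairing_apply hω F G x), fun _ _ _ => rfl⟩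

theorem theorem4p3 {E : Type*} [NormedAddCommGroup E] [NormedSpace ℝ E] [FiniteDimensional ℝ E]
    {H : Type*} [TopologicalSpace H] (I : ModelWithCorners ℝ E H) [I.Boundaryless]
    {X : Type*} [TopologicalSpace X] [T2Space X] [SecondCountableTopology X]
    [ChartedSpace H X] [IsManifold I ∞ X]
    (ω₃ : TwoPlectic.Ω I X 3) (hω : TwoPlectic.IsTwoPlectic ω₃) :
    ∃ L : Lie2Algebra ℝ (TwoPlectic.Ham ω₃) C^∞⟮I, X; ℝ⟯,
      (∀ (f : C^∞⟮I, X; ℝ⟯) (x : X), (L.d f).1 x = TwoPlectic.dFun I f x) ∧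
      (∀ (F G : TwoPlectic.Ham ω₃) (x : X),
        (L.bracket F G).1 x = TwoPlectic.lieDeriv I (TwoPlectic.hamField F) G.1 x) ∧
      (∀ (F : TwoPlectic.Ham ω₃) (f : C^∞⟮I, X; ℝ⟯) (x : X),
        L.bracket₀₁ F f x = TwoPlectic.lieDerivFun I (TwoPlectic.hamField F) f x) ∧
      (∀ (f : C^∞⟮I, X; ℝ⟯) (F : TwoPlectic.Ham ω₃), L.bracket₁₀ f F = 0) ∧
      (∀ (F G : TwoPlectic.Ham ω₃) (x : X),
        L.S F G x = -(TwoPlectic.pairing I (TwoPlectic.hamField F x) (G.1 x) +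
          TwoPlectic.pairing I (TwoPlectic.hamField G x) (F.1 x))) ∧
      L.IsHemistrict := by
  have : CompleteSpace E := FiniteDimensional.complete ℝ E
  exact theorem4p3_general I ω₃ hω
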